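/- All Hilbert spaces are complex and separable. Let $\mathbb{T}$ be the unit circle with normalized Lebesgue measure and $\mathbb{D}$ the open unit disc. For a Hilbert space $\mathcal{E}$, let $H^2_{\mathcal{E}}$ be the closed subspace of $L^2_{\mathcal{E}}(\mathbb{T})$ of functions whose Fourier coefficients of negative index all vanish. For Hilbert spaces $\mathcal{E}_1,\mathcal{E}_2$, let $L^\infty_{\mathscr{B}(\mathcal{E}_1,\mathcal{E}_2)}(\mathbb{T})$ be the set of essentially bounded functions $\Phi:\mathbb{T}\to\mathscr{B}(\mathcal{E}_1,\mathcal{E}_2)$ such that $z\mapsto\Phi(z)x$ is measurable for every $x\in\mathcal{E}_1$ (up to almost everywhere equality); $\mathscr{B}(\mathcal{E})$ stands for $\mathscr{B}(\mathcal{E},\mathcal{E})$. For such a $\Phi$ the Toeplitz operator $T_\Phi:H^2_{\mathcal{E}_1}\to H^2_{\mathcal{E}_2}$ is $T_\Phi f=P(\Phi f)$, where $P$ is the orthogonal projection of $L^2_{\mathcal{E}_2}(\mathbb{T})$ onto $H^2_{\mathcal{E}_2}$. A bounded analytic function $\Theta:\mathbb{D}\to\mathscr{B}(\mathcal{E}_1,\mathcal{E}_2)$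 is called inner if for almost every $z\in\mathbb{T}$ its radial limit $\Theta(z)=\lim_{r\to1^-}\Theta(rz)$ (in the strong operator topology) is an isometry; this boundary function is again denoted $\Theta$, and $T_\Theta$ is the Toeplitz operator with this symbol. A bounded operator $T$ between Hilbert spaces is norm-attaining if $\|Tf\|=\|T\|\,\|f\|$ for some $f\neq0$. **Theorem 4.1.** Let $\mathcal{E}$ be a Hilbert space and let $\Phi\in L^\infty_{\mathscr{B}(\mathcal{E})}(\mathbb{T})$ with $\|T_\Phi\|=1$. Then $T_\Phi$ is norm-attaining if and only if there exist a Hilbert space $\mathcal{E}_*\neq\{0\}$ and inner functions $\Theta,\Psi$ with values in $\mathscr{B}(\mathcal{E}_*,\mathcal{E})$ such that $\Theta(z)=\Phi(z)\Psi(z)$ for almost every $z\in\mathbb{T}$. Moreover, for all such $\mathcal{E}_*$, $\Theta$ and $\Psi$ one has $T_\Theta=T_\Phi T_\Psi$. -/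

import Mathlib

universe u

open MeasureTheory Filter Topology

noncomputable section

namespace ToeplitzNA

/-- Normalized Lebesgue measure on the unit circle. The circle is parametrized by
`t ∈ ℝ / ℤ`, the parameter `t` standing for the point `exp (2 π i t)`. -/
abbrev circleMeasure : Measure UnitAddCircle := AddCircle.haarAddCircle

/-- The Hilbert space of square integrable `E`-valued functions on the unit circle. -/
abbrev L2 (E : Type*) [NormedAddCommGroup E] [InnerProductSpace ℂ E] : Type _ :=
  Lp E 2 circleMeasure

/-- A bounded operator attains its norm. -/
def NormAttaining {H K : Type*} [NormedAddCommGroup H] [InnerProductSpace ℂ H]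
    [NormedAddCommGroup K] [InnerProductSpace ℂ K] (T : H →L[ℂ] K) : Prop :=
  ∃ f : H, f ≠ 0 ∧ ‖T f‖ = ‖T‖ * ‖f‖

section Hardy

variable {E : Type*} [NormedAddCommGroup E] [InnerProductSpace ℂ E]

lemma integrable_of_L2 (f : L2 E) : Integrable f circleMeasure :=
  (Lp.memLp f).integrable (by norm_num)

lemma fourierCoeff_add_L2 (f g : L2 E) (n : ℤ) :
    fourierCoeff (f + g : L2 E) n = fourierCoeff f n + fourierCoeff g n := by
  unfold fourierCoeff
  rw [← integral_add ((integrable_of_L2 f).fourier_smul (-n))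
    ((integrable_of_L2 g).fourier_smul (-n))]
  refine integral_congr_ae ?_
  filter_upwards [Lp.coeFn_add f g] with t ht
  rw [ht, Pi.add_apply, smul_add]

lemma fourierCoeff_smul_L2 (c : ℂ) (f : L2 E) (n : ℤ) :
    fourierCoeff (c • f : L2 E) n = c • fourierCoeff f n := by
  unfold fourierCoeff
  rw [← integral_smul]
  refine integral_congr_ae ?_
  filter_upwards [Lp.coeFn_smul c f] with t ht
  rw [ht, Pi.smul_apply, smul_comm]

lemma norm_fourierCoeff_L2_le (f : L2 E) (n : ℤ) : ‖fourierCoeff f n‖ ≤ ‖f‖ := by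
  have h1 : ‖fourierCoeff f n‖ ≤ ∫ t, ‖f t‖ ∂circleMeasure := by
    unfold fourierCoeff
    refine (norm_integral_le_integral_norm _).trans (le_of_eq ?_)
    refine integral_congr_ae (Eventually.of_forall fun t => ?_)
    simp only [norm_smul, fourier_apply, Circle.norm_coe, one_mul]
  refine h1.trans ?_
  rw [integral_norm_eq_lintegral_enorm (Lp.aestronglyMeasurable f), ← eLpNorm_one_eq_lintegral_enorm,
    Lp.norm_def]
  exact ENNReal.toReal_mono (Lp.eLpNorm_ne_top f)
    (eLpNorm_le_eLpNorm_of_exponent_le (by norm_num) (Lp.aestronglyMeasurable f))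

variable (E) in
/-- The Hardy space `H²` of `E`-valued functions, as the subspace of `L²` of the functions
whose Fourier coefficients of negative index vanish. -/
def H2 : Submodule ℂ (L2 E) where
  carrier := {f | ∀ n : ℤ, n < 0 → fourierCoeff f n = 0}
  zero_mem' := by
    intro n _
    have h := fourierCoeff_smul_L2 (0 : ℂ) (0 : L2 E) n
    simpa using h
  add_mem' := by
    intro f g hf hg n hn
    rw [fourierCoeff_add_L2, hf n hn, hg n hn, add_zero]
  smul_mem' := by
    intro c f hf n hn
    rw [fourierCoeff_smul_L2, hf n hn, smul_zero]

lemma isClosed_H2 : IsClosed (H2 E : Set (L2 E)) := by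
  have hc : ∀ n : ℤ, Continuous fun f : L2 E => fourierCoeff f n := fun n =>
    (LinearMap.mkContinuous
      ({ toFun := fun f => fourierCoeff f n
         map_add' := fun f g => fourierCoeff_add_L2 f g n
         map_smul' := fun c f => fourierCoeff_smul_L2 c f n } : L2 E →ₗ[ℂ] E) 1
      (fun f => by simpa using norm_fourierCoeff_L2_le f n)).continuous
  have h : (H2 E : Set (L2 E)) = ⋂ n : ℤ, ⋂ _ : n < 0, {f : L2 E | fourierCoeff f n = 0} := by
    ext f
    simp [H2]
  rw [h]
  exact isClosed_iInter fun n => isClosed_iInter fun _ => isClosed_eq (hc n) continuous_const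

instance [CompleteSpace E] : CompleteSpace (H2 E) :=
  isClosed_H2.completeSpace_coe

end Hardy

section Operators

variable {E₁ E₂ : Type*} [NormedAddCommGroup E₁] [InnerProductSpace ℂ E₁]
  [NormedAddCommGroup E₂] [InnerProductSpace ℂ E₂]

variable (E₁ E₂) in
/-- Essentially bounded operator-valued functions on the circle, measurable in the usual sense
for operator-valued functions: `t ↦ Φ t x` is (almost everywhere strongly) measurable for each
vector `x`. Functions are not identified here when they agree almost everywhere. -/
structure LInfty where
  toFun : UnitAddCircle → (E₁ →L[ℂ] E₂)
  aestronglyMeasurable' : ∀ x : E₁, AEStronglyMeasurable (fun t => toFun t x) circleMeasure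
  bounded' : ∃ C : ℝ, ∀ᵐ t ∂circleMeasure, ‖toFun t‖ ≤ C

instance : CoeFun (LInfty E₁ E₂) fun _ => UnitAddCircle → (E₁ →L[ℂ] E₂) := ⟨LInfty.toFun⟩

lemma LInfty.aestronglyMeasurable_apply (Φ : LInfty E₁ E₂) {f : UnitAddCircle → E₁}
    (hf : AEStronglyMeasurable f circleMeasure) :
    AEStronglyMeasurable (fun t => Φ t (f t)) circleMeasure := by
  obtain ⟨g, hg, hfg⟩ := hf
  have key : AEStronglyMeasurable (fun t => Φ t (g t)) circleMeasure := by
    refine aestronglyMeasurable_of_tendsto_ae atTop (f := fun n t => Φ t (hg.approx n t)) ?_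
      (Eventually.of_forall fun t => ((Φ t).continuous.tendsto _).comp (hg.tendsto_approx t))
    intro n
    have hs : (fun t => Φ t (hg.approx n t)) = fun t => ∑ c ∈ (hg.approx n).range,
        ((hg.approx n) ⁻¹' {c}).indicator (fun t => Φ t c) t := by
      funext t
      rw [Finset.sum_eq_single (hg.approx n t)]
      · simp
      · intro c _ hc
        exact Set.indicator_of_notMem (fun h => hc h.symm) _
      · intro h
        exact absurd (SimpleFunc.mem_range_self _ t) h
    rw [hs]
    exact Finset.aestronglyMeasurable_fun_sum _ fun c _ =>
      (Φ.aestronglyMeasurable' c).indicator ((hg.approx n).measurableSet_fiber c)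
  refine key.congr ?_
  filter_upwards [hfg] with t ht
  rw [ht]

lemma LInfty.memLp_apply (Φ : LInfty E₁ E₂) (f : L2 E₁) :
    MemLp (fun t => Φ t (f t)) 2 circleMeasure := by
  obtain ⟨C, hC⟩ := Φ.bounded'
  refine (Lp.memLp f).of_le_mul (c := C)
    (Φ.aestronglyMeasurable_apply (Lp.aestronglyMeasurable f)) ?_
  filter_upwards [hC] with t ht
  exact (Φ t).le_of_opNorm_le ht _

/-- The Laurent operator `(L_Φ f)(z) = Φ(z) f(z)`. -/
def laurent (Φ : LInfty E₁ E₂) : L2 E₁ →L[ℂ] L2 E₂ :=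
  LinearMap.mkContinuousOfExistsBound
    { toFun := fun f => (Φ.memLp_apply f).toLp _
      map_add' := by
        intro f g
        rw [← MemLp.toLp_add, MemLp.toLp_eq_toLp_iff]
        filter_upwards [Lp.coeFn_add f g] with t ht
        rw [ht, Pi.add_apply, Pi.add_apply, map_add]
      map_smul' := by
        intro c f
        rw [RingHom.id_apply, ← MemLp.toLp_const_smul, MemLp.toLp_eq_toLp_iff]
        filter_upwards [Lp.coeFn_smul c f] with t ht
        rw [ht, Pi.smul_apply, Pi.smul_apply, map_smul] }
    (by
      obtain ⟨C, hC⟩ := Φ.bounded'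
      refine ⟨C, fun f => Lp.norm_le_mul_norm_of_ae_le_mul ?_⟩
      filter_upwards [hC, (Φ.memLp_apply f).coeFn_toLp] with t ht ht'
      rw [LinearMap.coe_mk, AddHom.coe_mk, ht']
      exact (Φ t).le_of_opNorm_le ht _)

/-- The Toeplitz operator `T_Φ = P_{H²} L_Φ |_{H²}`. -/
def toeplitz [CompleteSpace E₂] (Φ : LInfty E₁ E₂) : H2 E₁ →L[ℂ] H2 E₂ :=
  (H2 E₂).orthogonalProjectionOnto ∘L laurent Φ ∘L (H2 E₁).subtypeL

/-- The operator `A` is the radial limit of `Θ` at the point `exp (2 π i t)` of the circle, in the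
strong operator topology. -/
def HasRadialLimitAt (Θ : ℂ → (E₁ →L[ℂ] E₂)) (t : UnitAddCircle) (A : E₁ →L[ℂ] E₂) : Prop :=
  ∀ x : E₁, Tendsto (fun r : ℝ => Θ ((r : ℂ) * (AddCircle.toCircle t : ℂ)) x) (𝓝[<] 1) (𝓝 (A x))

/-- Bounded analytic operator-valued functions on the open unit disc (values of `Θ` outside the
disc are irrelevant). -/
structure MemHInfty (Θ : ℂ → (E₁ →L[ℂ] E₂)) : Prop where
  differentiableOn : DifferentiableOn ℂ Θ (Metric.ball 0 1)
  bounded : ∃ C : ℝ, ∀ z ∈ Metric.ball (0 : ℂ) 1, ‖Θ z‖ ≤ C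

/-- Inner functions: bounded analytic functions on the disc whose radial limits are isometries
at almost every point of the circle. -/
structure IsInner (Θ : ℂ → (E₁ →L[ℂ] E₂)) : Prop extends MemHInfty Θ where
  ae_isometry : ∀ᵐ t ∂circleMeasure, ∃ A : E₁ →L[ℂ] E₂, HasRadialLimitAt Θ t A ∧ Isometry A

open scoped Classical in
/-- The boundary function of `Θ`: its radial limit wherever that exists, and `0` elsewhere. -/
def radialLimit (Θ : ℂ → (E₁ →L[ℂ] E₂)) (t : UnitAddCircle) : E₁ →L[ℂ] E₂ :=
  if h : ∃ A, HasRadialLimitAt Θ t A then h.choose else 0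

lemma HasRadialLimitAt.radialLimit_eq {Θ : ℂ → (E₁ →L[ℂ] E₂)} {t : UnitAddCircle}
    {A : E₁ →L[ℂ] E₂} (hA : HasRadialLimitAt Θ t A) : radialLimit Θ t = A := by
  have h : ∃ A, HasRadialLimitAt Θ t A := ⟨A, hA⟩
  rw [radialLimit, dif_pos h]
  ext x
  exact tendsto_nhds_unique (h.choose_spec x) (hA x)

/-- The boundary function of an inner function, as an essentially bounded function. -/
def IsInner.boundary {Θ : ℂ → (E₁ →L[ℂ] E₂)} (hΘ : IsInner Θ) : LInfty E₁ E₂ where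
  toFun := radialLimit Θ
  aestronglyMeasurable' := by
    intro x
    let u : ℕ → ℝ := fun n => 1 - 1 / ((n : ℝ) + 1)
    have hpos : ∀ n : ℕ, 0 < 1 / ((n : ℝ) + 1) := fun n => Nat.one_div_pos_of_nat
    have hle : ∀ n : ℕ, 1 / ((n : ℝ) + 1) ≤ 1 := fun n => by
      rw [div_le_one (by positivity)]
      linarith [n.cast_nonneg (α := ℝ)]
    have hu : Tendsto u atTop (𝓝[<] 1) := by
      refine tendsto_nhdsWithin_iff.2 ⟨?_, Eventually.of_forall fun n => ?_⟩
      · have h := (tendsto_const_nhds (x := (1 : ℝ))).sub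
          (tendsto_one_div_add_atTop_nhds_zero_nat (𝕜 := ℝ))
        rwa [sub_zero] at h
      · exact sub_lt_self 1 (hpos n)
    refine aestronglyMeasurable_of_tendsto_ae atTop
      (f := fun n t => Θ ((u n : ℂ) * (AddCircle.toCircle t : ℂ)) x) (fun n => ?_) ?_
    · have hm : ∀ t : UnitAddCircle,
          (u n : ℂ) * (AddCircle.toCircle t : ℂ) ∈ Metric.ball (0 : ℂ) 1 := by
        intro t
        have h0 : 0 ≤ u n := sub_nonneg.2 (hle n)
        rw [mem_ball_zero_iff, norm_mul, Circle.norm_coe, mul_one, Complex.norm_real,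
          Real.norm_of_nonneg h0]
        exact sub_lt_self 1 (hpos n)
      have hcont : Continuous fun t : UnitAddCircle =>
          Θ ((u n : ℂ) * (AddCircle.toCircle t : ℂ)) :=
        hΘ.differentiableOn.continuousOn.comp_continuous
          (continuous_const.mul (continuous_subtype_val.comp AddCircle.continuous_toCircle)) hm
      exact (hcont.clm_apply continuous_const).aestronglyMeasurable
    · filter_upwards [hΘ.ae_isometry] with t ht
      obtain ⟨A, hA, -⟩ := ht
      rw [hA.radialLimit_eq]
      exact (hA x).comp hu
  bounded' := by
    refine ⟨1, ?_⟩
    filter_upwards [hΘ.ae_isometry] with t ht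
    obtain ⟨A, hA, hi⟩ := ht
    rw [hA.radialLimit_eq]
    refine A.opNorm_le_bound zero_le_one fun x => ?_
    rw [one_mul, (AddMonoidHomClass.isometry_iff_norm A).1 hi x]

end Operators

end ToeplitzNA

end

/-! Write L for multiplication by Φ on L², so that T_Φ f = P L f on H².

Sufficiency: multiplication by the boundary values of an inner function maps H² into H² and
preserves norms (`IsInner.laurent_boundary_mem_H2`, `IsInner.norm_laurent_boundary`). No projection
is therefore needed between the factors, T_Θ = T_Φ T_Ψ (`toeplitz_comp_boundary`), and T_Φ attains
its norm 1 at T_Ψ f for any nonzero f, for instance a constant.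

Necessity: ‖L‖ ≤ ‖T_Φ‖ = 1 (`norm_laurent_apply_le`), so ‖T_Φ f‖ = ‖f‖ forces L f ∈ H² and L*L f =
f. The vectors of H² with these two properties form a nonzero closed shift-invariant subspace M. A
unit vector f of M orthogonal to zM (`exists_wandering_vector`) is orthogonal to all its positive
shifts; so is L f, because L commutes with the shift and preserves inner products on M. Hence every
nonzero Fourier coefficient of ‖f(z)‖² and of ‖(L f)(z)‖² vanishes, and both functions have norm one
almost everywhere (`ae_norm_eq_one`). A single such vector suffices: with a one-dimensional 𝓔_*, the
columns given by f and L f serve as Ψ and Θ. Their radial limits exist by Fatou's theorem for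
vector-valued functions (`ae_tendsto_holomorphicExtension`). -/

namespace ToeplitzNA

/-! ### Shifts, Fourier coefficients, and the norm of the Laurent operator. -/

section Shift

variable {E E₁ E₂ : Type*} [NormedAddCommGroup E] [InnerProductSpace ℂ E]
  [NormedAddCommGroup E₁] [InnerProductSpace ℂ E₁]
  [NormedAddCommGroup E₂] [InnerProductSpace ℂ E₂]

lemma laurent_coeFn (Φ : LInfty E₁ E₂) (f : L2 E₁) :
    laurent Φ f =ᵐ[circleMeasure] fun t => Φ t (f t) :=
  (Φ.memLp_apply f).coeFn_toLp

variable (E) in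
/-- The symbol `z ↦ z ^ m • 1`. -/
noncomputable def monomialSymbol (m : ℤ) : LInfty E E where
  toFun t := fourier m t • ContinuousLinearMap.id ℂ E
  aestronglyMeasurable' x := by
    refine Continuous.aestronglyMeasurable ?_
    exact (fourier (T := 1) m).continuous.smul continuous_const
  bounded' := ⟨1, Eventually.of_forall fun t => by
    rw [norm_smul, fourier_apply, Circle.norm_coe, one_mul]
    exact ContinuousLinearMap.norm_id_le⟩

/-- Multiplication by `z ^ m` on `L²`. -/
noncomputable def shift (m : ℤ) : L2 E →L[ℂ] L2 E := laurent (monomialSymbol E m)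

lemma shift_coeFn (m : ℤ) (f : L2 E) :
    shift m f =ᵐ[circleMeasure] fun t => fourier m t • f t :=
  laurent_coeFn (monomialSymbol E m) f

lemma norm_fourier_apply (m : ℤ) (t : UnitAddCircle) : ‖(fourier m t : ℂ)‖ = 1 := by
  rw [fourier_apply, Circle.norm_coe]

lemma inner_shift_shift (m : ℤ) (f g : L2 E) :
    inner ℂ (shift m f) (shift m g) = inner ℂ f g := by
  rw [L2.inner_def, L2.inner_def]
  refine integral_congr_ae ?_
  filter_upwards [shift_coeFn m f, shift_coeFn m g] with t h1 h2
  rw [h1, h2, inner_smul_left, inner_smul_right, ← mul_assoc, mul_comm (starRingEnd ℂ _),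
    Complex.mul_conj, Complex.normSq_eq_norm_sq, norm_fourier_apply]
  simp

lemma norm_shift (m : ℤ) (f : L2 E) : ‖shift m f‖ = ‖f‖ := by
  rw [@norm_eq_sqrt_re_inner ℂ, @norm_eq_sqrt_re_inner ℂ, inner_shift_shift]

lemma shift_shift (m n : ℤ) (f : L2 E) : shift m (shift n f) = shift (m + n) f := by
  refine Lp.ext ?_
  filter_upwards [shift_coeFn m (shift n f), shift_coeFn n f, shift_coeFn (m + n) f]
    with t h1 h2 h3
  rw [h1, h2, h3, smul_smul, fourier_add]

lemma shift_zero (f : L2 E) : shift 0 f = f := by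
  refine Lp.ext ?_
  filter_upwards [shift_coeFn 0 f] with t h1
  rw [h1, fourier_zero, one_smul]

lemma laurent_shift (Φ : LInfty E₁ E₂) (m : ℤ) (f : L2 E₁) :
    laurent Φ (shift m f) = shift m (laurent Φ f) := by
  refine Lp.ext ?_
  filter_upwards [shift_coeFn m f, shift_coeFn m (laurent Φ f), laurent_coeFn Φ f,
    laurent_coeFn Φ (shift m f)] with t h1 h2 h3 h4
  rw [h4, h1, h2, h3, map_smul]

lemma fourierCoeff_shift (m : ℤ) (f : L2 E) (n : ℤ) :
    fourierCoeff (shift m f) n = fourierCoeff f (n - m) := by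
  unfold fourierCoeff
  refine integral_congr_ae ?_
  filter_upwards [shift_coeFn m f] with t h1
  rw [h1, smul_smul, ← fourier_add]
  congr 3
  ring

lemma shift_mem_H2 {f : L2 E} (hf : f ∈ H2 E) {m : ℤ} (hm : 0 ≤ m) : shift m f ∈ H2 E := by
  intro n hn
  rw [fourierCoeff_shift]
  exact hf _ (by lia)

/-- The function `z ↦ z ^ n • y`. -/
noncomputable def monomial (n : ℤ) (y : E) : L2 E :=
  MemLp.toLp (fun t : UnitAddCircle => (fourier n t : ℂ) • y) (by
    refine MemLp.of_bound (Continuous.aestronglyMeasurable (by fun_prop)) ‖y‖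
      (Eventually.of_forall fun t => ?_)
    rw [norm_smul, norm_fourier_apply, one_mul])

lemma monomial_coeFn (n : ℤ) (y : E) :
    monomial n y =ᵐ[circleMeasure] fun t => (fourier n t : ℂ) • y :=
  MemLp.coeFn_toLp _

lemma inner_monomial [CompleteSpace E] (n : ℤ) (y : E) (f : L2 E) :
    inner ℂ (monomial n y) f = inner ℂ y (fourierCoeff f n) := by
  rw [L2.inner_def, fourierCoeff, ← integral_inner ((integrable_of_L2 f).fourier_smul (-n))]
  refine integral_congr_ae ?_
  filter_upwards [monomial_coeFn n y] with t h1
  rw [h1, inner_smul_left, inner_smul_right, fourier_neg]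

lemma fourierCoeff_monomial [CompleteSpace E] (n : ℤ) (y : E) (m : ℤ) :
    fourierCoeff (monomial n y) m = if m = n then y else 0 := by
  have h1 : fourierCoeff (monomial n y) m
      = ∫ t : UnitAddCircle, (fourier (n - m) t : ℂ) • y ∂circleMeasure := by
    unfold fourierCoeff
    refine integral_congr_ae ?_
    filter_upwards [monomial_coeFn n y] with t h1
    rw [h1, smul_smul, ← fourier_add]
    congr 3
    ring
  have h2 := congrFun (fourierCoeff_fourier (T := 1) n) m
  have h3 : fourierCoeff (fourier (T := 1) n) m
      = ∫ t : UnitAddCircle, (fourier (n - m) t : ℂ) ∂circleMeasure := by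
    unfold fourierCoeff
    refine integral_congr_ae (Eventually.of_forall fun t => ?_)
    simp only [smul_eq_mul]
    rw [← fourier_add]
    congr 2
    ring
  rw [h1, integral_smul_const, ← h3, h2, Pi.single_apply]
  split_ifs <;> simp

lemma monomial_mem_H2 [CompleteSpace E] {n : ℤ} (hn : 0 ≤ n) (y : E) : monomial n y ∈ H2 E := by
  intro m hm
  rw [fourierCoeff_monomial, if_neg (by lia)]

/-- Pairing with a fixed vector reduces this to completeness of the scalar Fourier basis;
separability lets countably many vectors decide whether f vanishes almost everywhere. -/
lemma eq_zero_of_fourierCoeff_eq_zero [CompleteSpace E] [TopologicalSpace.SeparableSpace E]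
    {f : L2 E} (hf : ∀ n, fourierCoeff f n = 0) : f = 0 := by
  have : SecondCountableTopology E := UniformSpace.secondCountable_of_separable E
  have key : (f : UnitAddCircle → E) =ᵐ[circleMeasure] 0 := by
    refine ae_eq_zero_of_forall_inner (𝕜 := ℂ) fun c => ?_
    have hm : MemLp (fun t => inner ℂ c (f t)) 2 circleMeasure := (Lp.memLp f).const_inner c
    have h0 : hm.toLp _ = 0 := by
      refine fourierBasis.repr.map_eq_zero_iff.1 ?_
      ext n
      rw [fourierBasis_repr, fourierCoeff_congr_ae hm.coeFn_toLp]
      have h1 : fourierCoeff (fun t => inner ℂ c (f t)) n = inner ℂ c (fourierCoeff f n) := by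
        unfold fourierCoeff
        rw [← integral_inner ((integrable_of_L2 f).fourier_smul (-n))]
        refine integral_congr_ae (Eventually.of_forall fun t => ?_)
        simp only [inner_smul_right, smul_eq_mul]
      rw [h1, hf, inner_zero_right]
      rfl
    have h2 := hm.coeFn_toLp
    rw [h0] at h2
    exact h2.symm.trans (Lp.coeFn_zero _ _ _)
  exact Lp.ext (key.trans (Lp.coeFn_zero _ _ _).symm)

variable (E) in
/-- The functions whose negative Fourier spectrum is bounded below. -/
def spectrumBoundedBelow : Submodule ℂ (L2 E) where
  carrier := {f | ∃ N : ℤ, ∀ m, N ≤ m → shift m f ∈ H2 E}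
  zero_mem' := ⟨0, fun m _ => by rw [map_zero]; exact zero_mem _⟩
  add_mem' := by
    rintro f g ⟨N, hN⟩ ⟨M, hM⟩
    exact ⟨max N M, fun m hm => by
      rw [map_add]; exact add_mem (hN m (by lia)) (hM m (by lia))⟩
  smul_mem' := by
    rintro c f ⟨N, hN⟩
    exact ⟨N, fun m hm => by rw [map_smul]; exact Submodule.smul_mem _ _ (hN m hm)⟩

/-- Every monomial, of negative degree too, lies in this subspace, so a function orthogonal to it
has no Fourier coefficients. -/
lemma dense_spectrumBoundedBelow [CompleteSpace E] [TopologicalSpace.SeparableSpace E] :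
    Dense (spectrumBoundedBelow E : Set (L2 E)) := by
  rw [Submodule.dense_iff_topologicalClosure_eq_top, Submodule.topologicalClosure_eq_top_iff,
    Submodule.eq_bot_iff]
  intro f hf
  refine eq_zero_of_fourierCoeff_eq_zero fun n => ?_
  have hmem : monomial n (fourierCoeff f n) ∈ spectrumBoundedBelow E := by
    refine ⟨-n, fun m hm k hk => ?_⟩
    rw [fourierCoeff_shift, fourierCoeff_monomial, if_neg (by lia)]
  have h := (Submodule.mem_orthogonal _ _).1 hf _ hmem
  rwa [inner_monomial, inner_self_eq_zero] at h

/-- The Laurent operator is bounded by the norm of the Toeplitz operator with the same symbol. -/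
lemma norm_laurent_apply_le [CompleteSpace E₁] [TopologicalSpace.SeparableSpace E₁]
    [CompleteSpace E₂] [TopologicalSpace.SeparableSpace E₂] (Φ : LInfty E₁ E₂) (f : L2 E₁) :
    ‖laurent Φ f‖ ≤ ‖toeplitz Φ‖ * ‖f‖ := by
  have key : ∀ p : L2 E₁ × L2 E₂,
      ‖inner ℂ (laurent Φ p.1) p.2‖ ≤ ‖toeplitz Φ‖ * ‖p.1‖ * ‖p.2‖ := by
    have hcl : IsClosed {p : L2 E₁ × L2 E₂ |
        ‖inner ℂ (laurent Φ p.1) p.2‖ ≤ ‖toeplitz Φ‖ * ‖p.1‖ * ‖p.2‖} :=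
      isClosed_le (by fun_prop) (by fun_prop)
    have hd := (dense_spectrumBoundedBelow (E := E₁)).prod (dense_spectrumBoundedBelow (E := E₂))
    intro p
    refine closure_minimal (s := (spectrumBoundedBelow E₁ : Set (L2 E₁)) ×ˢ
      (spectrumBoundedBelow E₂ : Set (L2 E₂))) ?_ hcl (hd p)
    rintro ⟨f, g⟩ ⟨⟨N, hN⟩, ⟨M, hM⟩⟩
    change ‖inner ℂ (laurent Φ f) g‖ ≤ ‖toeplitz Φ‖ * ‖f‖ * ‖g‖
    have hf := hN (max N M) (le_max_left _ _)
    have hg := hM (max N M) (le_max_right _ _)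
    set m := max N M
    -- One shift pushes both functions into H² without changing the pairing, as L commutes with it;
    -- paired with an element of H², L acts as the Toeplitz operator.
    have h1 : inner ℂ (laurent Φ f) g
        = inner ℂ (toeplitz Φ ⟨shift m f, hf⟩) (⟨shift m g, hg⟩ : H2 E₂) := by
      rw [← inner_shift_shift m, ← laurent_shift]
      exact (Submodule.inner_orthogonalProjectionOnto_eq_of_mem_right
        (⟨shift m g, hg⟩ : H2 E₂) (laurent Φ (shift m f))).symm
    rw [h1]
    refine (norm_inner_le_norm (𝕜 := ℂ) (toeplitz Φ ⟨shift m f, hf⟩) ⟨shift m g, hg⟩).trans ?_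
    have h2 := (toeplitz Φ).le_opNorm ⟨shift m f, hf⟩
    simp only [Submodule.coe_norm, norm_shift] at h2 ⊢
    gcongr
  have h := key (f, laurent Φ f)
  simp only [inner_self_eq_norm_sq_to_K] at h
  rw [norm_pow, RCLike.norm_ofReal, abs_norm, pow_two] at h
  rcases (norm_nonneg (laurent Φ f)).eq_or_lt with h0 | h0
  · rw [← h0]; positivity
  · exact le_of_mul_le_mul_right h h0

end Shift

/-! ### Wandering vectors have constant pointwise norm. -/

section Unimodular

open scoped ENNReal NNReal BoundedContinuousFunction

/-- Finite measures on the circle are determined by their Fourier coefficients. -/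
lemma measure_ext_of_integral_fourier {P Q : Measure UnitAddCircle} [IsFiniteMeasure P]
    [IsFiniteMeasure Q]
    (h : ∀ n : ℤ, ∫ t, (fourier n t : ℂ) ∂P = ∫ t, (fourier n t : ℂ) ∂Q) : P = Q := by
  let A : StarSubalgebra ℂ (UnitAddCircle →ᵇ ℂ) :=
    (fourierSubalgebra (T := 1)).comap (BoundedContinuousFunction.toContinuousMapStarₐ ℂ)
  have hint : ∀ (R : Measure UnitAddCircle) [IsFiniteMeasure R] (g : C(UnitAddCircle, ℂ)),
      Integrable g R := fun R _ g => g.continuous.integrable_of_hasCompactSupport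
        (HasCompactSupport.of_compactSpace _)
  refine ext_of_forall_mem_subalgebra_integral_eq_of_pseudoEMetric_complete_countable
    (A := A) (𝕜 := ℂ) ?_ ?_
  · intro x y hxy
    obtain ⟨f, ⟨g, hg, rfl⟩, hne⟩ := fourierSubalgebra_separatesPoints (T := 1) hxy
    exact ⟨g, ⟨g, ⟨BoundedContinuousFunction.mkOfCompact g, hg, rfl⟩, rfl⟩, hne⟩
  · intro g hg
    have hg' : g.toContinuousMap ∈ Submodule.span ℂ (Set.range (fourier (T := 1))) := by
      rw [← fourierSubalgebra_coe]; exact hg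
    have key : ∀ f ∈ Submodule.span ℂ (Set.range (fourier (T := 1))),
        ∫ x, f x ∂P = ∫ x, f x ∂Q := by
      intro f hf
      induction hf using Submodule.span_induction with
      | mem x hx => obtain ⟨n, rfl⟩ := hx; exact h n
      | zero => simp
      | add x y _ _ hx hy =>
        simp only [ContinuousMap.add_apply]
        rw [integral_add (hint P x) (hint P y), integral_add (hint Q x) (hint Q y), hx, hy]
      | smul c x _ hx =>
        simp only [ContinuousMap.smul_apply, integral_smul, hx]
    exact key _ hg'

lemma integral_fourier (n : ℤ) :
    ∫ t : UnitAddCircle, (fourier n t : ℂ) ∂circleMeasure = if n = 0 then 1 else 0 := by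
  have h2 := congrFun (fourierCoeff_fourier (T := 1) n) 0
  rw [Pi.single_apply] at h2
  have h3 : fourierCoeff (fourier (T := 1) n) 0
      = ∫ t : UnitAddCircle, (fourier n t : ℂ) ∂circleMeasure := by
    unfold fourierCoeff
    refine integral_congr_ae (Eventually.of_forall fun t => ?_)
    simp
  rw [← h3, h2]
  simp only [eq_comm]

/-- A unit vector of `L²` which is orthogonal to its positive shifts has pointwise norm one. -/
lemma ae_norm_eq_one {E : Type*} [NormedAddCommGroup E] [InnerProductSpace ℂ E] {f : L2 E}
    (h1 : ‖f‖ = 1) (h : ∀ n : ℕ, 0 < n → inner ℂ (shift (n : ℤ) f) f = 0) :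
    ∀ᵐ t ∂circleMeasure, ‖f t‖ = 1 := by
  -- These are the Fourier coefficients of ‖f‖²; the negative shifts follow from the positive ones
  -- by unitarity.
  have hz : ∀ n : ℤ, inner ℂ f (shift n f) = if n = 0 then 1 else 0 := by
    intro n
    rcases lt_trichotomy n 0 with hn | hn | hn
    · rw [if_neg hn.ne, ← inner_shift_shift (-n), shift_shift, neg_add_cancel, shift_zero]
      have := h n.natAbs (by lia)
      rwa [Int.ofNat_natAbs_of_nonpos hn.le] at this
    · subst hn
      rw [shift_zero, inner_self_eq_norm_sq_to_K, h1]
      simp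
    · rw [if_neg hn.ne']
      have := h n.natAbs (by lia)
      rw [Int.natAbs_of_nonneg hn.le] at this
      rw [← inner_conj_symm, this, map_zero]
  let g : UnitAddCircle → E := (Lp.aestronglyMeasurable f).mk f
  have hg : StronglyMeasurable g := (Lp.aestronglyMeasurable f).stronglyMeasurable_mk
  have hfg : f =ᵐ[circleMeasure] g := (Lp.aestronglyMeasurable f).ae_eq_mk
  let w : UnitAddCircle → ℝ≥0 := fun t => ‖g t‖₊ ^ 2
  have hw : Measurable w := hg.nnnorm.measurable.pow_const 2
  have hint : ∫⁻ t, (w t : ℝ≥0∞) ∂circleMeasure ≠ ∞ := by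
    have h2 : MemLp g 2 circleMeasure := (memLp_congr_ae hfg).1 (Lp.memLp f)
    have h3 := h2.integrable_norm_pow (by norm_num)
    have h4 := h3.2.ne
    convert h4 using 4 with t
    simp [w, enorm_eq_nnnorm]
  have : IsFiniteMeasure (circleMeasure.withDensity fun t => (w t : ℝ≥0∞)) :=
    isFiniteMeasure_withDensity hint
  -- The measures ‖f‖² dm and dm have the same Fourier coefficients, so their densities agree almost
  -- everywhere.
  have heq : circleMeasure.withDensity (fun t => (w t : ℝ≥0∞))
      = circleMeasure.withDensity (fun _ => 1) := by
    have h1' : circleMeasure.withDensity (fun _ => 1) = circleMeasure := by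
      rw [show (fun _ : UnitAddCircle => (1 : ℝ≥0∞)) = 1 from rfl, withDensity_one]
    rw [h1']
    refine measure_ext_of_integral_fourier fun n => ?_
    rw [integral_withDensity_eq_integral_smul hw, integral_fourier, ← hz n, L2.inner_def]
    refine integral_congr_ae ?_
    filter_upwards [hfg, shift_coeFn n f] with t ht ht'
    rw [ht', ht, inner_smul_right, inner_self_eq_norm_sq_to_K, NNReal.smul_def, mul_comm]
    simp [w]
  have h5 := (withDensity_eq_iff hw.coe_nnreal_ennreal.aemeasurable aemeasurable_const hint).1 heq
  filter_upwards [h5, hfg] with t ht ht'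
  rw [ht']
  have h6 : w t = 1 := by exact_mod_cast ht
  have h7 : ‖g t‖ ^ 2 = 1 := by
    have := congrArg NNReal.toReal h6
    simpa [w] using this
  exact (pow_eq_one_iff_of_nonneg (norm_nonneg _) two_ne_zero).1 h7

end Unimodular

/-! ### Holomorphic extension and the Poisson integral. -/

section Poisson

variable {E : Type*} [NormedAddCommGroup E] [InnerProductSpace ℂ E]

lemma norm_pow_smul_le {a : ℂ} {r : ℝ} (h : ‖a‖ ≤ r) (n : ℕ) (x : E) :
    ‖a ^ n • x‖ ≤ r ^ n * ‖x‖ := by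
  rw [norm_smul, norm_pow]
  gcongr

lemma integrable_pow_smul {f : UnitAddCircle → E} (hf : Integrable f circleMeasure)
    {a : UnitAddCircle → ℂ} (ha : Continuous a) {r : ℝ} (har : ∀ x, ‖a x‖ ≤ r) (n : ℕ) :
    Integrable (fun x => a x ^ n • f x) circleMeasure :=
  (hf.norm.const_mul (r ^ n)).mono' ((ha.pow n).aestronglyMeasurable.smul hf.1)
    (Eventually.of_forall fun x => norm_pow_smul_le (har x) n (f x))

lemma hasSum_integral_pow_smul {f : UnitAddCircle → E} (hf : Integrable f circleMeasure)
    {a : UnitAddCircle → ℂ} (ha : Continuous a) {r : ℝ} (hr0 : 0 ≤ r) (hr : r < 1)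
    (har : ∀ x, ‖a x‖ ≤ r) :
    HasSum (fun n : ℕ => ∫ x, a x ^ n • f x ∂circleMeasure)
      (∫ x, (1 - a x)⁻¹ • f x ∂circleMeasure) := by
  have h := hasSum_integral_of_summable_integral_norm
    (F := fun (n : ℕ) x => a x ^ n • f x) (μ := circleMeasure)
    (integrable_pow_smul hf ha har) ?_
  · convert h using 1
    refine integral_congr_ae (Eventually.of_forall fun x => ?_)
    exact ((hasSum_geometric_of_norm_lt_one ((har x).trans_lt hr)).smul_const (f x)).tsum_eq.symm
  · refine Summable.of_nonneg_of_le (fun n => integral_nonneg fun x => norm_nonneg _)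
      (fun n => ?_) ((summable_geometric_of_lt_one hr0 hr).mul_right
        (∫ x, ‖f x‖ ∂circleMeasure))
    rw [← integral_const_mul]
    exact integral_mono_of_nonneg (Eventually.of_forall fun x => norm_nonneg _)
      (hf.norm.const_mul _) (Eventually.of_forall fun x => norm_pow_smul_le (har x) n (f x))

/-- The Poisson kernel of the disc. -/
noncomputable def poisson (z : ℂ) (x : UnitAddCircle) : ℝ :=
  (1 - ‖z‖ ^ 2) / ‖1 - z * fourier (-1) x‖ ^ 2

/-- The holomorphic function on the disc with the Fourier coefficients of `f`. -/
noncomputable def holomorphicExtension (f : UnitAddCircle → E) (z : ℂ) : E :=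
  ∑' n : ℕ, z ^ n • fourierCoeff f n

lemma norm_mul_fourier (z : ℂ) (n : ℤ) (x : UnitAddCircle) : ‖z * fourier n x‖ = ‖z‖ := by
  rw [norm_mul, norm_fourier_apply, mul_one]

lemma one_sub_mul_fourier_ne_zero {z : ℂ} (hz : ‖z‖ < 1) (n : ℤ) (x : UnitAddCircle) :
    1 - z * fourier n x ≠ 0 := by
  intro h
  have h1 := norm_mul_fourier z n x
  rw [← sub_eq_zero.1 h, norm_one] at h1
  linarith

lemma poisson_nonneg {z : ℂ} (hz : ‖z‖ < 1) (x : UnitAddCircle) : 0 ≤ poisson z x := by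
  have : ‖z‖ ^ 2 ≤ 1 := pow_le_one₀ (norm_nonneg z) hz.le
  exact div_nonneg (by linarith) (by positivity)

lemma continuous_poisson {z : ℂ} (hz : ‖z‖ < 1) : Continuous (poisson z) := by
  unfold poisson
  refine continuous_const.div (by fun_prop) fun x => ?_
  exact pow_ne_zero _ (norm_ne_zero_iff.2 (one_sub_mul_fourier_ne_zero hz _ x))

lemma inv_add_inv_conj_sub_one {a : ℂ} (ha : 1 - a ≠ 0) :
    (1 - a)⁻¹ + (1 - starRingEnd ℂ a)⁻¹ - 1 = (((1 - ‖a‖ ^ 2) / ‖1 - a‖ ^ 2 : ℝ) : ℂ) := by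
  have h1 : (1 - starRingEnd ℂ a) = starRingEnd ℂ (1 - a) := by simp
  have h2 : (1 - starRingEnd ℂ a) ≠ 0 := by
    rw [h1]; exact (map_ne_zero _).2 ha
  push_cast
  rw [← Complex.mul_conj', ← Complex.mul_conj', ← h1]
  field_simp
  ring

lemma fourier_pow (n : ℕ) (m : ℤ) (x : UnitAddCircle) :
    (fourier m x : ℂ) ^ n = fourier (n * m) x := by
  induction n with
  | zero => simp
  | succ k ih => rw [pow_succ, ih, ← fourier_add]; congr 2; push_cast; ring

lemma integrable_poisson_smul {f : UnitAddCircle → E} (hf : Integrable f circleMeasure)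
    {z : ℂ} (hz : ‖z‖ < 1) : Integrable (fun x => poisson z x • f x) circleMeasure := by
  obtain ⟨B, hB⟩ := isCompact_univ.exists_bound_of_continuousOn (continuous_poisson hz).continuousOn
  refine (hf.norm.const_mul B).mono' ((continuous_poisson hz).aestronglyMeasurable.smul hf.1)
    (Eventually.of_forall fun x => ?_)
  rw [norm_smul]
  exact mul_le_mul_of_nonneg_right (hB x trivial) (norm_nonneg _)

/-- The Poisson kernel is the sum of two conjugate geometric series minus 1
(`inv_add_inv_conj_sub_one`). The first integrates to the power series; in the second only the
constant term survives, since negative coefficients vanish, and it cancels the 1. -/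
lemma holomorphicExtension_eq_integral {f : UnitAddCircle → E} (hf : Integrable f circleMeasure)
    (hneg : ∀ n : ℤ, n < 0 → fourierCoeff f n = 0) {z : ℂ} (hz : ‖z‖ < 1) :
    holomorphicExtension f z = ∫ x, poisson z x • f x ∂circleMeasure := by
  have hca : Continuous fun x : UnitAddCircle => z * fourier (-1) x := by fun_prop
  have hcb : Continuous fun x : UnitAddCircle => starRingEnd ℂ z * fourier 1 x := by fun_prop
  have h1 := hasSum_integral_pow_smul hf hca (norm_nonneg z) hz
    (fun x => (norm_mul_fourier z _ x).le)
  have h2 := hasSum_integral_pow_smul hf hcb (norm_nonneg z) hz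
    (fun x => by rw [norm_mul_fourier, RCLike.norm_conj])
  have e1 : ∀ n : ℕ, ∫ x, (z * fourier (-1) x) ^ n • f x ∂circleMeasure
      = z ^ n • fourierCoeff f n := by
    intro n
    rw [fourierCoeff, ← integral_smul]
    refine integral_congr_ae (Eventually.of_forall fun x => ?_)
    simp only [mul_pow, fourier_pow, smul_smul, mul_neg, mul_one]
  have e2 : ∀ n : ℕ, n ≠ 0 →
      ∫ x, (starRingEnd ℂ z * fourier 1 x) ^ n • f x ∂circleMeasure = 0 := by
    intro n hn
    have h3 := hneg (-n) (by lia)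
    rw [fourierCoeff] at h3
    rw [← smul_zero (starRingEnd ℂ z ^ n), ← h3, ← integral_smul]
    refine integral_congr_ae (Eventually.of_forall fun x => ?_)
    simp only [mul_pow, fourier_pow, smul_smul, mul_one, neg_neg]
  simp only [e1] at h1
  have h3 := h2.unique (hasSum_single 0 e2)
  simp only [pow_zero, one_smul] at h3
  have hb : ∀ x : UnitAddCircle,
      starRingEnd ℂ z * fourier 1 x = starRingEnd ℂ (z * fourier (-1) x) := by
    intro x
    rw [map_mul, fourier_neg, Complex.conj_conj]
  have hint : ∀ {b : UnitAddCircle → ℂ}, Continuous b → (∀ x, ‖b x‖ ≤ ‖z‖) →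
      Integrable (fun x => (1 - b x)⁻¹ • f x) circleMeasure := by
    intro b hb1 hb2
    refine hf.bdd_smul (1 - ‖z‖)⁻¹ (Continuous.aestronglyMeasurable ?_)
      (Eventually.of_forall fun x => ?_)
    · refine (continuous_const.sub hb1).inv₀ fun x h => ?_
      have := hb2 x
      rw [← sub_eq_zero.1 h, norm_one] at this
      linarith
    · rw [norm_inv]
      refine inv_anti₀ (by linarith) ?_
      have := norm_sub_norm_le (1 : ℂ) (b x)
      rw [norm_one] at this
      linarith [hb2 x]
  have i1 := hint hca (fun x => (norm_mul_fourier z _ x).le)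
  have i2 := hint hcb (fun x => by rw [norm_mul_fourier, RCLike.norm_conj])
  calc holomorphicExtension f z
      = (∫ x, (1 - z * fourier (-1) x)⁻¹ • f x ∂circleMeasure)
        + (∫ x, (1 - starRingEnd ℂ z * fourier 1 x)⁻¹ • f x ∂circleMeasure)
        - ∫ x, f x ∂circleMeasure := by rw [h3, add_sub_cancel_right]; exact h1.tsum_eq
    _ = ∫ x, poisson z x • f x ∂circleMeasure := by
      rw [← integral_add i1 i2]
      refine (integral_sub (i1.add i2) hf).symm.trans ?_
      refine integral_congr_ae (Eventually.of_forall fun x => ?_)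
      have h4 := inv_add_inv_conj_sub_one (one_sub_mul_fourier_ne_zero hz (-1) x)
      rw [norm_mul_fourier] at h4
      simp only [hb]
      change (1 - z * fourier (-1) x)⁻¹ • f x
        + (1 - starRingEnd ℂ (z * fourier (-1) x))⁻¹ • f x - f x
        = (((1 - ‖z‖ ^ 2) / ‖1 - z * fourier (-1) x‖ ^ 2 : ℝ) : ℂ) • f x
      rw [← h4, sub_smul, add_smul, one_smul]

lemma integral_poisson {z : ℂ} (hz : ‖z‖ < 1) : ∫ x, poisson z x ∂circleMeasure = 1 := by
  have hc : ∀ n : ℤ, fourierCoeff (fun _ : UnitAddCircle => (1 : ℂ)) n = if n = 0 then 1 else 0 := by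
    intro n
    simp only [fourierCoeff, smul_eq_mul, mul_one, integral_fourier, neg_eq_zero]
  have h := holomorphicExtension_eq_integral (f := fun _ : UnitAddCircle => (1 : ℂ))
    (integrable_const _) (fun n hn => by rw [hc, if_neg hn.ne]) hz
  have h1 : holomorphicExtension (fun _ : UnitAddCircle => (1 : ℂ)) z = 1 := by
    rw [holomorphicExtension, tsum_eq_single 0]
    · simp [hc]
    · intro n hn
      simp [hc, hn]
  rw [h1] at h
  have h2 : ∫ x, poisson z x • (1 : ℂ) ∂circleMeasure
      = ((∫ x, poisson z x ∂circleMeasure : ℝ) : ℂ) := by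
    rw [integral_smul_const]
    simp
  rw [h2] at h
  exact_mod_cast h.symm

lemma integrable_poisson {z : ℂ} (hz : ‖z‖ < 1) : Integrable (poisson z) circleMeasure :=
  (continuous_poisson hz).integrable_of_hasCompactSupport (HasCompactSupport.of_compactSpace _)

lemma norm_holomorphicExtension_le {f : UnitAddCircle → E} (hf : Integrable f circleMeasure)
    (hneg : ∀ n : ℤ, n < 0 → fourierCoeff f n = 0) {C : ℝ} (hC : ∀ᵐ t ∂circleMeasure, ‖f t‖ ≤ C)
    {z : ℂ} (hz : ‖z‖ < 1) : ‖holomorphicExtension f z‖ ≤ C := by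
  rw [holomorphicExtension_eq_integral hf hneg hz]
  calc ‖∫ x, poisson z x • f x ∂circleMeasure‖
      ≤ ∫ x, poisson z x * C ∂circleMeasure := by
        refine norm_integral_le_of_norm_le ((integrable_poisson hz).mul_const C) ?_
        filter_upwards [hC] with t ht
        rw [norm_smul, Real.norm_of_nonneg (poisson_nonneg hz t)]
        exact mul_le_mul_of_nonneg_left ht (poisson_nonneg hz t)
    _ = C := by rw [integral_mul_const, integral_poisson hz, one_mul]

lemma norm_holomorphicExtension_sub_le [CompleteSpace E] {f : UnitAddCircle → E}
    (hf : Integrable f circleMeasure)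
    (hneg : ∀ n : ℤ, n < 0 → fourierCoeff f n = 0) (c : E) {z : ℂ} (hz : ‖z‖ < 1) :
    ‖holomorphicExtension f z - c‖ ≤ ∫ x, poisson z x * ‖f x - c‖ ∂circleMeasure := by
  have h1 : c = ∫ x, poisson z x • c ∂circleMeasure := by
    rw [integral_smul_const, integral_poisson hz, one_smul]
  rw [holomorphicExtension_eq_integral hf hneg hz]
  conv_lhs => rw [h1]
  rw [← integral_sub (integrable_poisson_smul hf hz)
    ((integrable_poisson hz).smul_const c)]
  refine (norm_integral_le_integral_norm _).trans (le_of_eq ?_)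
  refine integral_congr_ae (Eventually.of_forall fun x => ?_)
  simp only
  rw [← smul_sub, norm_smul, Real.norm_of_nonneg (poisson_nonneg hz x)]

/-- The Weierstrass test applies on each smaller disc, the coefficients being bounded by ‖f‖. -/
lemma differentiableOn_holomorphicExtension [CompleteSpace E] (f : L2 E) :
    DifferentiableOn ℂ (holomorphicExtension f) (Metric.ball 0 1) := by
  intro z hz
  rw [mem_ball_zero_iff] at hz
  obtain ⟨ρ, hzρ, hρ⟩ := exists_between hz
  have h : DifferentiableOn ℂ (holomorphicExtension f) (Metric.ball 0 ρ) := by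
    unfold holomorphicExtension
    refine Complex.differentiableOn_tsum_of_summable_norm (u := fun n => ρ ^ n * ‖f‖)
      ((summable_geometric_of_lt_one ((norm_nonneg z).trans hzρ.le) hρ).mul_right _)
      (fun n => by fun_prop) Metric.isOpen_ball fun n w hw => ?_
    rw [mem_ball_zero_iff] at hw
    exact (norm_pow_smul_le hw.le n _).trans
      (mul_le_mul_of_nonneg_left (norm_fourierCoeff_L2_le f n)
        (pow_nonneg ((norm_nonneg z).trans hzρ.le) n))
  exact (h.differentiableAt (Metric.isOpen_ball.mem_nhds (mem_ball_zero_iff.2 hzρ))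
    ).differentiableWithinAt

end Poisson

/-! ### Radial limits at Lebesgue points. -/

section Fatou

variable {E : Type*} [NormedAddCommGroup E] [InnerProductSpace ℂ E]

lemma circleMeasure_eq_volume : circleMeasure = (volume : Measure UnitAddCircle) := by
  rw [AddCircle.volume_eq_smul_haarAddCircle, ENNReal.ofReal_one, one_smul]

lemma exists_real_rep (u : UnitAddCircle) : ∃ y : ℝ, (y : UnitAddCircle) = u ∧ |y| = ‖u‖ := by
  obtain ⟨y, rfl⟩ := QuotientAddGroup.mk_surjective u
  refine ⟨y - round y, ?_, (UnitAddCircle.norm_eq).symm⟩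
  rw [AddCircle.coe_sub, sub_eq_self]
  exact (AddCircle.coe_eq_zero_iff 1).2 ⟨round y, by simp⟩

lemma norm_le_half (u : UnitAddCircle) : ‖u‖ ≤ 1 / 2 := by
  simpa using AddCircle.norm_le_half_period (x := u) 1 one_ne_zero

/-- For a representative y with |y| ≤ 1/2 the right side equals (1 - r)² + 4r sin²(πy), and
|sin(πy)| ≥ 2|y|. -/
lemma sq_add_sq_le_norm_one_sub_sq {r : ℝ} (hr : 1 / 2 ≤ r) (u : UnitAddCircle) :
    (1 - r) ^ 2 + ‖u‖ ^ 2 ≤ ‖1 - (r : ℂ) * fourier 1 u‖ ^ 2 := by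
  obtain ⟨y, rfl, hy⟩ := exists_real_rep u
  have hy2 : |y| ≤ 1 / 2 := hy ▸ norm_le_half _
  rw [← hy, sq_abs]
  have h1 : (fourier 1 (y : UnitAddCircle) : ℂ)
      = Complex.exp ((2 * Real.pi * y : ℝ) * Complex.I) := by
    rw [fourier_coe_apply]
    congr 1
    push_cast
    ring
  have h2 : ‖1 - (r : ℂ) * fourier 1 (y : UnitAddCircle)‖ ^ 2
      = (1 - r) ^ 2 + 4 * r * Real.sin (Real.pi * y) ^ 2 := by
    rw [h1, ← Complex.normSq_eq_norm_sq, Complex.normSq_apply]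
    simp only [Complex.sub_re, Complex.sub_im, Complex.one_re, Complex.one_im, Complex.re_ofReal_mul,
      Complex.im_ofReal_mul, Complex.exp_ofReal_mul_I_re, Complex.exp_ofReal_mul_I_im]
    have h3 := Real.sin_sq_add_cos_sq (2 * Real.pi * y)
    have h4 : Real.cos (2 * Real.pi * y) = 1 - 2 * Real.sin (Real.pi * y) ^ 2 := by
      rw [mul_assoc, Real.cos_two_mul, Real.cos_sq']
      ring
    have h5 : Real.sin (2 * Real.pi * y) ^ 2 = 1 - Real.cos (2 * Real.pi * y) ^ 2 := by linarith
    linear_combination r ^ 2 * h5 - 2 * r * h4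
  have h6 : 2 * |y| ≤ |Real.sin (Real.pi * y)| := by
    have h := Real.mul_abs_le_abs_sin (x := Real.pi * y) (by
      rw [abs_mul, abs_of_pos Real.pi_pos]
      nlinarith [Real.pi_pos])
    rw [abs_mul, abs_of_pos Real.pi_pos] at h
    calc 2 * |y| = 2 / Real.pi * (Real.pi * |y|) := by field_simp
      _ ≤ _ := h
  have h7 : (2 * |y|) ^ 2 ≤ Real.sin (Real.pi * y) ^ 2 := by
    rw [← sq_abs (Real.sin _)]
    exact pow_le_pow_left₀ (by positivity) h6 2
  rw [mul_pow, sq_abs] at h7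
  rw [h2]
  nlinarith [sq_nonneg y, sq_nonneg (Real.sin (Real.pi * y))]

lemma poisson_le {r : ℝ} (hr : 1 / 2 ≤ r) (hr1 : r < 1) (t x : UnitAddCircle) :
    poisson ((r : ℂ) * (AddCircle.toCircle t : ℂ)) x
      ≤ 2 * (1 - r) / ((1 - r) ^ 2 + dist x t ^ 2) := by
  have h1 : (r : ℂ) * (AddCircle.toCircle t : ℂ) * fourier (-1) x = r * fourier 1 (t - x) := by
    rw [fourier_one, sub_eq_add_neg, AddCircle.toCircle_add, fourier_apply, neg_one_zsmul,
      Circle.coe_mul, mul_assoc]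
  have h2 := sq_add_sq_le_norm_one_sub_sq hr (t - x)
  have h3 : dist x t = ‖t - x‖ := by rw [dist_comm, dist_eq_norm]
  have h4 : ‖(r : ℂ) * (AddCircle.toCircle t : ℂ)‖ = r := by
    rw [norm_mul, Circle.norm_coe, mul_one, Complex.norm_real, Real.norm_of_nonneg (by linarith)]
  rw [poisson, h1, h3, h4]
  have h5 : 0 < 1 - r := by linarith
  exact div_le_div₀ (by nlinarith) (by nlinarith) (by positivity) h2

/-- This dominates the kernel by multiples of normalized indicators of balls of radius 2^k ε, with
summable weights. If k ≥ 1 is the least index with u ≤ 2^k ε, then u > 2^(k-1) ε bounds the kernel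
by 2ε / (4^(k-1) ε²), which is the k-th term; hence the 8. -/
lemma dyadic_majorant {ε u : ℝ} (hε : 0 < ε) (K : ℕ) (hK : u ≤ 2 ^ K * ε) :
    2 * ε / (ε ^ 2 + u ^ 2)
      ≤ ∑ k ∈ Finset.range (K + 1), if u ≤ 2 ^ k * ε then 8 / 2 ^ k * (2 ^ k * ε)⁻¹ else 0 := by
  have hnn : ∀ k : ℕ, 0 ≤ if u ≤ 2 ^ k * ε then 8 / 2 ^ k * (2 ^ k * ε)⁻¹ else 0 := by
    intro k
    split_ifs <;> positivity
  induction K with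
  | zero =>
    rw [pow_zero, one_mul] at hK
    simp only [zero_add, Finset.range_one, Finset.sum_singleton, pow_zero, one_mul, if_pos hK]
    rw [div_one, ← div_eq_mul_inv, div_le_div_iff₀ (by positivity) hε]
    nlinarith [sq_nonneg u, sq_nonneg ε]
  | succ K ih =>
    rw [Finset.sum_range_succ]
    by_cases h : u ≤ 2 ^ K * ε
    · exact (ih h).trans (le_add_of_nonneg_right (hnn _))
    · refine le_add_of_nonneg_of_le (Finset.sum_nonneg fun k _ => hnn k) ?_
      rw [if_pos hK, ← div_eq_mul_inv, div_div, div_le_div_iff₀ (by positivity) (by positivity)]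
      push Not at h
      have h2 : (2 ^ K * ε) ^ 2 ≤ u ^ 2 := pow_le_pow_left₀ (by positivity) h.le 2
      rw [pow_succ]
      nlinarith [sq_nonneg ε]

/-- **Fatou's theorem** for bounded vector-valued functions with analytic Fourier series. -/
theorem ae_tendsto_holomorphicExtension [CompleteSpace E] {f : UnitAddCircle → E}
    (hf : Integrable f circleMeasure) (hneg : ∀ n : ℤ, n < 0 → fourierCoeff f n = 0) {C : ℝ}
    (hC : ∀ᵐ t ∂circleMeasure, ‖f t‖ ≤ C) :
    ∀ᵐ t ∂circleMeasure,
      Tendsto (fun r : ℝ => holomorphicExtension f ((r : ℂ) * (AddCircle.toCircle t : ℂ)))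
        (𝓝[<] 1) (𝓝 (f t)) := by
  have : IsUnifLocDoublingMeasure circleMeasure := by
    rw [circleMeasure_eq_volume]; infer_instance
  filter_upwards [hC, IsUnifLocDoublingMeasure.ae_tendsto_average_norm_sub circleMeasure
    hf.locallyIntegrable 1] with t htC hL
  have hC0 : 0 ≤ C := (norm_nonneg _).trans htC
  let g : UnitAddCircle → ℝ := fun x => ‖f x - f t‖
  have hg : Integrable g circleMeasure := (hf.sub (integrable_const _)).norm
  have hg0 : ∀ x, 0 ≤ g x := fun x => norm_nonneg _
  have hgC : ∀ᵐ x ∂circleMeasure, g x ≤ 2 * C := by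
    filter_upwards [hC] with x hx
    exact (norm_sub_le _ _).trans (by linarith)
  -- Up to a factor 2 this is the mean oscillation of f about t on small balls: it tends to 0 at a
  -- Lebesgue point, and boundedness of f gives a bound at all scales.
  let A : ℝ → ℝ := fun s => s⁻¹ * ∫ x in Metric.closedBall t s, g x ∂circleMeasure
  have hball : ∀ s : ℝ, 0 < s →
      circleMeasure.real (Metric.closedBall t s) = min 1 (2 * s) := by
    intro s hs
    rw [circleMeasure_eq_volume, Measure.real, AddCircle.volume_closedBall,
      ENNReal.toReal_ofReal (by positivity)]
  have hA0 : ∀ s, 0 < s → 0 ≤ A s := fun s hs =>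
    mul_nonneg (inv_nonneg.2 hs.le) (integral_nonneg hg0)
  have hAC : ∀ s, 0 < s → A s ≤ 4 * C := by
    intro s hs
    have h1 : ∫ x in Metric.closedBall t s, g x ∂circleMeasure ≤ 2 * C * (2 * s) := by
      calc ∫ x in Metric.closedBall t s, g x ∂circleMeasure
          ≤ ∫ x in Metric.closedBall t s, 2 * C ∂circleMeasure :=
            integral_mono_ae hg.integrableOn (integrable_const _) (ae_restrict_of_ae hgC)
        _ = circleMeasure.real (Metric.closedBall t s) * (2 * C) := by
            rw [setIntegral_const, smul_eq_mul]
        _ ≤ (2 * s) * (2 * C) := by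
            rw [hball s hs]
            gcongr
            exact min_le_right _ _
        _ = _ := mul_comm _ _
    calc A s ≤ s⁻¹ * (2 * C * (2 * s)) := by
          exact mul_le_mul_of_nonneg_left h1 (inv_nonneg.2 hs.le)
      _ = 4 * C := by field_simp; ring
  have hAlim : Tendsto A (𝓝[>] 0) (𝓝 0) := by
    have h1 := hL (l := 𝓝[>] (0 : ℝ)) (fun _ => t) id tendsto_id (by
      filter_upwards [self_mem_nhdsWithin] with s hs
      exact Metric.mem_closedBall_self (by rw [one_mul]; exact le_of_lt hs))
    have h2 := h1.const_mul 2
    rw [mul_zero] at h2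
    refine h2.congr' ?_
    filter_upwards [Ioc_mem_nhdsGT (show (0 : ℝ) < 1 / 2 by norm_num)] with s hs
    rw [setAverage_eq, id, hball s hs.1, min_eq_right (by linarith [hs.2]), smul_eq_mul]
    have := hs.1
    simp only [A, g]
    field_simp
  have hscale : ∀ k : ℕ, Tendsto (fun r : ℝ => 2 ^ k * (1 - r)) (𝓝[<] 1) (𝓝[>] 0) := by
    intro k
    refine tendsto_nhdsWithin_iff.2 ⟨?_, ?_⟩
    · have : Tendsto (fun r : ℝ => 2 ^ k * (1 - r)) (𝓝 1) (𝓝 (2 ^ k * (1 - 1))) :=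
        Continuous.tendsto (by fun_prop) 1
      rw [sub_self, mul_zero] at this
      exact this.mono_left nhdsWithin_le_nhds
    · filter_upwards [self_mem_nhdsWithin] with r hr
      have : 0 < 1 - r := sub_pos.2 hr
      exact mul_pos (by positivity) this
  have hsumb : Summable fun k : ℕ => (8 : ℝ) / 2 ^ k * (4 * C) := by
    have : Summable fun k : ℕ => (8 * (4 * C)) * (1 / 2 : ℝ) ^ k :=
      summable_geometric_two.mul_left _
    refine this.congr fun k => ?_
    rw [one_div, inv_pow]
    ring
  have hbd : ∀ r : ℝ, r < 1 → ∀ k : ℕ, ‖8 / 2 ^ k * A (2 ^ k * (1 - r))‖ ≤ 8 / 2 ^ k * (4 * C) := by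
    intro r hr k
    have hs : 0 < 2 ^ k * (1 - r) := mul_pos (by positivity) (sub_pos.2 hr)
    rw [Real.norm_of_nonneg (mul_nonneg (by positivity) (hA0 _ hs))]
    exact mul_le_mul_of_nonneg_left (hAC _ hs) (by positivity)
  -- Each term tends to 0 and the weights 8 / 2^k are summable, so dominated convergence applies to
  -- the series.
  have hlim : Tendsto (fun r : ℝ => ∑' k : ℕ, 8 / 2 ^ k * A (2 ^ k * (1 - r))) (𝓝[<] 1) (𝓝 0) := by
    have h := tendsto_tsum_of_dominated_convergence (𝓕 := 𝓝[<] (1 : ℝ))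
      (f := fun r (k : ℕ) => 8 / 2 ^ k * A (2 ^ k * (1 - r))) (g := fun _ => 0) hsumb
      (fun k => by
        have := (hAlim.comp (hscale k)).const_mul (8 / 2 ^ k)
        rwa [mul_zero] at this)
      (by
        filter_upwards [self_mem_nhdsWithin] with r hr
        exact hbd r hr)
    rwa [tsum_zero] at h
  rw [tendsto_iff_norm_sub_tendsto_zero]
  refine squeeze_zero' (Eventually.of_forall fun r => norm_nonneg _) ?_ hlim
  filter_upwards [Ico_mem_nhdsLT (show (1 / 2 : ℝ) < 1 by norm_num)] with r hr
  obtain ⟨hr2, hr1⟩ := hr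
  have hε : 0 < 1 - r := by linarith
  have hz : ‖(r : ℂ) * (AddCircle.toCircle t : ℂ)‖ < 1 := by
    rwa [norm_mul, Circle.norm_coe, mul_one, Complex.norm_real, Real.norm_of_nonneg (by linarith)]
  -- K is chosen so that the largest ball, of radius at least 1/2, covers the whole circle.
  obtain ⟨K, hK⟩ := pow_unbounded_of_one_lt (1 / (1 - r)) (one_lt_two)
  have hK1 : 1 / 2 ≤ 2 ^ K * (1 - r) := by
    rw [div_lt_iff₀ hε] at hK
    linarith
  refine (norm_holomorphicExtension_sub_le hf hneg (f t) hz).trans ?_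
  have hi : ∀ k : ℕ, Integrable (fun x => (Metric.closedBall t (2 ^ k * (1 - r))).indicator
      (fun x => 8 / 2 ^ k * (2 ^ k * (1 - r))⁻¹ * g x) x) circleMeasure := fun k =>
    (hg.const_mul _).indicator measurableSet_closedBall
  calc ∫ x, poisson ((r : ℂ) * (AddCircle.toCircle t : ℂ)) x * ‖f x - f t‖ ∂circleMeasure
      ≤ ∫ x, ∑ k ∈ Finset.range (K + 1), (Metric.closedBall t (2 ^ k * (1 - r))).indicator
          (fun x => 8 / 2 ^ k * (2 ^ k * (1 - r))⁻¹ * g x) x ∂circleMeasure := by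
        refine integral_mono_of_nonneg (Eventually.of_forall fun x =>
          mul_nonneg (poisson_nonneg hz x) (norm_nonneg _)) (integrable_finsetSum _ fun k _ => hi k)
          (Eventually.of_forall fun x => ?_)
        have h1 := (poisson_le hr2 hr1 t x).trans (dyadic_majorant hε K
          ((by rw [dist_eq_norm]; exact norm_le_half _ : dist x t ≤ 1 / 2).trans hK1))
        refine (mul_le_mul_of_nonneg_right h1 (hg0 x)).trans (le_of_eq ?_)
        rw [Finset.sum_mul]
        refine Finset.sum_congr rfl fun k _ => ?_
        classical
        rw [Set.indicator_apply, ite_mul, zero_mul]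
        simp only [Metric.mem_closedBall]
    _ = ∑ k ∈ Finset.range (K + 1), 8 / 2 ^ k * A (2 ^ k * (1 - r)) := by
        rw [integral_finsetSum _ fun k _ => hi k]
        refine Finset.sum_congr rfl fun k _ => ?_
        rw [integral_indicator measurableSet_closedBall, integral_const_mul, mul_assoc]
    _ ≤ _ := by
        refine Summable.sum_le_tsum _ (fun k _ => mul_nonneg (by positivity)
          (hA0 _ (mul_pos (by positivity) hε))) (Summable.of_norm_bounded hsumb (hbd r hr1))

end Fatou

/-! ### Inner functions act isometrically on H². -/

section InnerFunctions

open scoped NNReal ENNReal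

variable {E₁ E₂ E₃ : Type*} [NormedAddCommGroup E₁] [InnerProductSpace ℂ E₁]
  [NormedAddCommGroup E₂] [InnerProductSpace ℂ E₂]
  [NormedAddCommGroup E₃] [InnerProductSpace ℂ E₃]

lemma integral_fourier_smul_comp_clm [CompleteSpace E₁] [CompleteSpace E₂] {f : L2 E₁}
    (hf : f ∈ H2 E₁) (c : E₁ →L[ℂ] E₂) {m : ℤ} (hm : 0 < m) :
    ∫ t, (fourier m t : ℂ) • c (f t) ∂circleMeasure = 0 := by
  have h1 : ∫ t, (fourier m t : ℂ) • c (f t) ∂circleMeasure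
      = c (∫ t, (fourier m t : ℂ) • f t ∂circleMeasure) := by
    rw [← c.integral_comp_comm ((integrable_of_L2 f).fourier_smul m)]
    simp only [map_smul]
  have h2 := hf (-m) (by lia)
  rw [fourierCoeff, neg_neg] at h2
  rw [h1, h2, map_zero]

lemma norm_ofReal_mul_toCircle {r : ℝ} (hr : 0 ≤ r) (t : UnitAddCircle) :
    ‖(r : ℂ) * (AddCircle.toCircle t : ℂ)‖ = r := by
  rw [norm_mul, Circle.norm_coe, mul_one, Complex.norm_real, Real.norm_of_nonneg hr]

/-- Expanding Ψ in its power series on a disc of radius R > r and integrating termwise, each term is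
a Fourier coefficient of f of negative index, up to a bounded operator and a scalar. -/
lemma integral_fourier_smul_dilation [CompleteSpace E₁] [CompleteSpace E₂]
    {Ψ : ℂ → (E₁ →L[ℂ] E₂)} (hΨ : DifferentiableOn ℂ Ψ (Metric.ball 0 1)) {f : L2 E₁}
    (hf : f ∈ H2 E₁) {m : ℤ} (hm : 0 < m) {r : ℝ} (hr0 : 0 ≤ r) (hr1 : r < 1) :
    ∫ t, (fourier m t : ℂ) • Ψ ((r : ℂ) * (AddCircle.toCircle t : ℂ)) (f t) ∂circleMeasure = 0 := by
  obtain ⟨R, hrR, hR1⟩ := exists_between hr1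
  lift r to ℝ≥0 using hr0
  lift R to ℝ≥0 using r.coe_nonneg.trans hrR.le
  have hps := (hΨ.mono (Metric.closedBall_subset_ball hR1)).hasFPowerSeriesOnBall
    (lt_of_le_of_lt (zero_le) (NNReal.coe_lt_coe.1 hrR))
  set p := cauchyPowerSeries Ψ 0 R
  have hsum : Summable fun k => ‖p.coeff k‖ * (r : ℝ) ^ k := by
    have := p.summable_norm_mul_pow (r := r)
      (lt_of_lt_of_le (ENNReal.coe_lt_coe.2 (NNReal.coe_lt_coe.1 hrR)) hps.r_le)
    simpa only [FormalMultilinearSeries.norm_apply_eq_norm_coef] using this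
  let F : ℕ → UnitAddCircle → E₂ := fun k t =>
    (r : ℂ) ^ k • (fourier (m + k) t : ℂ) • p.coeff k (f t)
  have hFi : ∀ k, Integrable (F k) circleMeasure := fun k =>
    (((p.coeff k).integrable_comp (integrable_of_L2 f)).fourier_smul (m + k)).smul ((r : ℂ) ^ k)
  have hF0 : ∀ k, ∫ t, F k t ∂circleMeasure = 0 := fun k => by
    rw [integral_smul, integral_fourier_smul_comp_clm hf _ (by lia), smul_zero]
  have hFs : Summable fun k => ∫ t, ‖F k t‖ ∂circleMeasure := by
    refine Summable.of_nonneg_of_le (fun k => integral_nonneg fun _ => norm_nonneg _) (fun k => ?_)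
      (hsum.mul_right (∫ t, ‖f t‖ ∂circleMeasure))
    rw [← integral_const_mul]
    refine integral_mono_of_nonneg (Eventually.of_forall fun x => norm_nonneg _)
      ((integrable_of_L2 f).norm.const_mul _) (Eventually.of_forall fun t => ?_)
    simp only [F]
    rw [norm_smul, norm_smul, norm_fourier_apply, one_mul, norm_pow, Complex.norm_real,
      Real.norm_of_nonneg r.coe_nonneg, mul_comm ‖p.coeff k‖, mul_assoc]
    exact mul_le_mul_of_nonneg_left ((p.coeff k).le_opNorm _) (pow_nonneg r.coe_nonneg k)
  have h := hasSum_integral_of_summable_integral_norm hFi hFs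
  simp only [hF0] at h
  rw [hasSum_zero.unique h]
  refine integral_congr_ae (Eventually.of_forall fun t => ?_)
  have h1 : HasSum (fun k => ((r : ℂ) * (AddCircle.toCircle t : ℂ)) ^ k • p.coeff k)
      (Ψ ((r : ℂ) * (AddCircle.toCircle t : ℂ))) := by
    have := hps.hasSum (y := (r : ℂ) * (AddCircle.toCircle t : ℂ)) (by
      rw [Metric.mem_eball, edist_zero_right, ← ofReal_norm, norm_ofReal_mul_toCircle r.coe_nonneg,
        ENNReal.ofReal_coe_nnreal]
      exact ENNReal.coe_lt_coe.2 (NNReal.coe_lt_coe.1 hrR))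
    rw [zero_add] at this
    simpa only [FormalMultilinearSeries.apply_eq_pow_smul_coeff] using this
  have h2 := (h1.mapL (ContinuousLinearMap.apply ℂ E₂ (f t))).const_smul (fourier m t : ℂ)
  refine (h2.tsum_eq.symm.trans ?_)
  refine tsum_congr fun k => ?_
  simp only [F, ContinuousLinearMap.apply_apply, _root_.smul_apply]
  rw [fourier_add, ← fourier_one, mul_pow, fourier_pow, mul_one, smul_smul, smul_smul]
  congr 1
  ring_nf

/-- The negative coefficients vanish for each dilation z ↦ Ψ(rz); dominated convergence carries this
to r → 1. -/
lemma IsInner.laurent_boundary_mem_H2 [CompleteSpace E₁] [CompleteSpace E₂]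
    {Ψ : ℂ → (E₁ →L[ℂ] E₂)} (hΨ : IsInner Ψ) {f : L2 E₁} (hf : f ∈ H2 E₁) :
    laurent hΨ.boundary f ∈ H2 E₂ := by
  intro n hn
  obtain ⟨C, hC⟩ := hΨ.bounded
  have hev : ∀ᶠ r : ℝ in 𝓝[<] 1, 0 ≤ r ∧ r < 1 := Ico_mem_nhdsLT one_pos
  have hmem : ∀ {r : ℝ}, 0 ≤ r ∧ r < 1 → ∀ t : UnitAddCircle,
      (r : ℂ) * (AddCircle.toCircle t : ℂ) ∈ Metric.ball (0 : ℂ) 1 := fun hr t => by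
    rw [mem_ball_zero_iff, norm_ofReal_mul_toCircle hr.1]
    exact hr.2
  have hlim := tendsto_integral_filter_of_dominated_convergence (μ := circleMeasure)
    (l := 𝓝[<] (1 : ℝ))
    (F := fun r t => (fourier (-n) t : ℂ) • Ψ ((r : ℂ) * (AddCircle.toCircle t : ℂ)) (f t))
    (f := fun t => (fourier (-n) t : ℂ) • laurent hΨ.boundary f t)
    (fun t => C * ‖f t‖) ?_ ?_ ((integrable_of_L2 f).norm.const_mul C) ?_
  · refine tendsto_nhds_unique hlim (tendsto_const_nhds.congr' ?_)
    filter_upwards [hev] with r hr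
    exact (integral_fourier_smul_dilation hΨ.differentiableOn hf (by lia) hr.1 hr.2).symm
  · filter_upwards [hev] with r hr
    have hcont : Continuous fun t : UnitAddCircle => Ψ ((r : ℂ) * (AddCircle.toCircle t : ℂ)) :=
      hΨ.differentiableOn.continuousOn.comp_continuous
        (continuous_const.mul (continuous_subtype_val.comp AddCircle.continuous_toCircle)) (hmem hr)
    exact (fourier (T := 1) (-n)).continuous.aestronglyMeasurable.smul
      (isBoundedBilinearMap_apply.continuous.comp_aestronglyMeasurable
        (hcont.aestronglyMeasurable.prodMk (Lp.aestronglyMeasurable f)))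
  · filter_upwards [hev] with r hr
    refine Eventually.of_forall fun t => ?_
    rw [norm_smul, norm_fourier_apply, one_mul]
    exact ContinuousLinearMap.le_of_opNorm_le _ (hC _ (hmem hr t)) _
  · filter_upwards [hΨ.ae_isometry, laurent_coeFn hΨ.boundary f] with t ht ht'
    obtain ⟨A, hA, -⟩ := ht
    rw [ht']
    change Tendsto _ _ (𝓝 ((fourier (-n) t : ℂ) • radialLimit Ψ t (f t)))
    rw [hA.radialLimit_eq]
    exact (hA (f t)).const_smul _

lemma IsInner.norm_laurent_boundary {Ψ : ℂ → (E₁ →L[ℂ] E₂)} (hΨ : IsInner Ψ) (f : L2 E₁) :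
    ‖laurent hΨ.boundary f‖ = ‖f‖ := by
  have h : ∀ᵐ t ∂circleMeasure, ‖laurent hΨ.boundary f t‖ = ‖f t‖ := by
    filter_upwards [hΨ.ae_isometry, laurent_coeFn hΨ.boundary f] with t ht ht'
    obtain ⟨A, hA, hi⟩ := ht
    rw [ht']
    change ‖radialLimit Ψ t (f t)‖ = _
    rw [hA.radialLimit_eq, (AddMonoidHomClass.isometry_iff_norm A).1 hi]
  exact le_antisymm (Lp.norm_le_norm_of_ae_le (h.mono fun t ht => ht.le))
    (Lp.norm_le_norm_of_ae_le (h.mono fun t ht => ht.ge))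

lemma toeplitz_apply_of_mem [CompleteSpace E₂] (Φ : LInfty E₁ E₂) {f : H2 E₁}
    (h : laurent Φ f ∈ H2 E₂) : toeplitz Φ f = ⟨laurent Φ f, h⟩ :=
  Submodule.orthogonalProjectionOnto_mem_subspace_eq_self (⟨laurent Φ f, h⟩ : H2 E₂)

lemma norm_toeplitz_boundary [CompleteSpace E₁] [CompleteSpace E₂]
    {Ψ : ℂ → (E₁ →L[ℂ] E₂)} (hΨ : IsInner Ψ) (f : H2 E₁) :
    ‖toeplitz hΨ.boundary f‖ = ‖f‖ := by
  rw [toeplitz_apply_of_mem _ (hΨ.laurent_boundary_mem_H2 f.2)]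
  exact hΨ.norm_laurent_boundary f

lemma toeplitz_comp_boundary [CompleteSpace E₁] [CompleteSpace E₂] [CompleteSpace E₃]
    (Φ : LInfty E₂ E₃) {Θ : LInfty E₁ E₃} {Ψ : ℂ → (E₁ →L[ℂ] E₂)} (hΨ : IsInner Ψ)
    (h : ∀ᵐ t ∂circleMeasure, Θ t = Φ t ∘L hΨ.boundary t) :
    toeplitz Θ = toeplitz Φ ∘L toeplitz hΨ.boundary := by
  ext1 f
  rw [ContinuousLinearMap.comp_apply,
    toeplitz_apply_of_mem hΨ.boundary (hΨ.laurent_boundary_mem_H2 f.2)]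
  change (H2 E₃).orthogonalProjectionOnto (laurent Θ f)
    = (H2 E₃).orthogonalProjectionOnto (laurent Φ (laurent hΨ.boundary f))
  congr 1
  refine Lp.ext ?_
  filter_upwards [h, laurent_coeFn Θ f, laurent_coeFn hΨ.boundary f,
    laurent_coeFn Φ (laurent hΨ.boundary f)] with t h1 h2 h3 h4
  rw [h2, h4, h3, h1, ContinuousLinearMap.comp_apply]

end InnerFunctions

/-! ### Wandering vectors of shift-invariant subspaces. -/

section Wandering

variable {E : Type*} [NormedAddCommGroup E] [InnerProductSpace ℂ E] [CompleteSpace E]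
  [TopologicalSpace.SeparableSpace E]

/-- A nonzero closed shift-invariant subspace of `H²` contains a wandering unit vector. -/
lemma exists_wandering_vector {M : Submodule ℂ (L2 E)} (hcl : IsClosed (M : Set (L2 E)))
    (hH : M ≤ H2 E) (hne : M ≠ ⊥) (hS : ∀ f ∈ M, shift 1 f ∈ M) :
    ∃ f ∈ M, ‖f‖ = 1 ∧ ∀ n : ℕ, 0 < n → inner ℂ (shift (n : ℤ) f) f = 0 := by
  let S : L2 E →L[ℂ] L2 E := shift 1
  let N : Submodule ℂ (L2 E) := M.map S.toLinearMap
  have hNM : N ≤ M := by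
    rintro _ ⟨f, hf, rfl⟩
    exact hS f hf
  have hNcl : IsClosed (N : Set (L2 E)) := by
    have hiso : Isometry S := AddMonoidHomClass.isometry_of_norm S (norm_shift 1)
    have := hiso.isClosedEmbedding.isClosedMap _ hcl
    simpa [N] using this
  have : CompleteSpace N := hNcl.completeSpace_coe
  -- Otherwise zM = M, so each element of M is divisible in M by every power of z.
  have hW : Nᗮ ⊓ M ≠ ⊥ := by
    intro h0
    have hNM' : N = M := by
      have := Submodule.sup_orthogonal_inf_of_hasOrthogonalProjection hNM
      rwa [h0, sup_bot_eq] at this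
    refine hne ((Submodule.eq_bot_iff _).2 fun f hf => ?_)
    have hdiv : ∀ n : ℕ, ∃ g ∈ M, f = shift (n : ℤ) g := by
      intro n
      induction n with
      | zero => exact ⟨f, hf, by rw [Nat.cast_zero, shift_zero]⟩
      | succ k ih =>
        obtain ⟨g, hg, rfl⟩ := ih
        rw [← hNM'] at hg
        obtain ⟨g', hg', rfl⟩ := hg
        refine ⟨g', hg', ?_⟩
        rw [Nat.cast_succ]
        exact shift_shift _ _ _
    refine eq_zero_of_fourierCoeff_eq_zero fun k => ?_
    -- Dividing by one power more than k makes the coefficient's index negative.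
    obtain ⟨g, hg, rfl⟩ := hdiv (k.toNat + 1)
    rw [fourierCoeff_shift]
    exact hH hg _ (by push_cast; lia)
  obtain ⟨f, ⟨hfN, hfM⟩, hf0⟩ := Submodule.exists_mem_ne_zero_of_ne_bot hW
  have hpow : ∀ (n : ℕ) (g : L2 E), g ∈ M → shift (n : ℤ) g ∈ M := by
    intro n
    induction n with
    | zero => intro g hg; rwa [Nat.cast_zero, shift_zero]
    | succ k ih =>
      intro g hg
      rw [Nat.cast_succ, ← shift_shift]
      exact ih _ (hS g hg)
  have hwand : ∀ n : ℕ, 0 < n → inner ℂ (shift (n : ℤ) f) f = 0 := by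
    intro n hn
    obtain ⟨k, rfl⟩ := Nat.exists_eq_succ_of_ne_zero hn.ne'
    refine (Submodule.mem_orthogonal _ _).1 hfN _ ⟨shift (k : ℤ) f, hpow k f hfM, ?_⟩
    rw [Nat.cast_succ, add_comm]
    exact shift_shift _ _ _
  refine ⟨((‖f‖ : ℂ)⁻¹) • f, M.smul_mem _ hfM, norm_smul_inv_norm hf0, fun n hn => ?_⟩
  rw [map_smul, inner_smul_left, inner_smul_right, hwand n hn, mul_zero, mul_zero]

end Wandering

/-! ### Inner functions with a single column. -/

section Columns

variable {E F : Type*} [NormedAddCommGroup E] [InnerProductSpace ℂ E] [CompleteSpace E]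
  [NormedAddCommGroup F] [InnerProductSpace ℂ F]

lemma ae_hasRadialLimitAt_smulRight (l : F →L[ℂ] ℂ) {f : L2 E} (hf : f ∈ H2 E)
    (h1 : ∀ᵐ t ∂circleMeasure, ‖f t‖ = 1) :
    ∀ᵐ t ∂circleMeasure,
      HasRadialLimitAt (fun z => l.smulRight (holomorphicExtension f z)) t (l.smulRight (f t)) := by
  filter_upwards [ae_tendsto_holomorphicExtension (integrable_of_L2 f) hf
    (h1.mono fun t ht => ht.le)] with t ht x
  exact ht.const_smul (l x)

/-- The isometric functional l identifies F with a subspace of ℂ, so at the boundary isometry only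
requires ‖f(t)‖ = 1. -/
lemma isInner_smulRight {l : F →L[ℂ] ℂ} (hl : ∀ x, ‖l x‖ = ‖x‖) {f : L2 E} (hf : f ∈ H2 E)
    (h1 : ∀ᵐ t ∂circleMeasure, ‖f t‖ = 1) :
    IsInner (fun z => l.smulRight (holomorphicExtension f z)) where
  differentiableOn :=
    (ContinuousLinearMap.smulRightL ℂ F E l).differentiable.comp_differentiableOn
      (differentiableOn_holomorphicExtension f)
  bounded := by
    refine ⟨‖l‖, fun z hz => ?_⟩
    rw [ContinuousLinearMap.norm_smulRight_apply]
    refine mul_le_of_le_one_right (norm_nonneg _) ?_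
    exact norm_holomorphicExtension_le (integrable_of_L2 f) hf (h1.mono fun t ht => ht.le)
      (mem_ball_zero_iff.1 hz)
  ae_isometry := by
    filter_upwards [ae_hasRadialLimitAt_smulRight l hf h1, h1] with t ht ht1
    refine ⟨_, ht, AddMonoidHomClass.isometry_of_norm _ fun x => ?_⟩
    rw [ContinuousLinearMap.smulRight_apply, norm_smul, ht1, mul_one, hl]

end Columns

/-! ### The two directions of the equivalence. -/

section NormAttaining

variable {E : Type u} [NormedAddCommGroup E] [InnerProductSpace ℂ E] [CompleteSpace E]

/-- If a Toeplitz operator of norm one attains its norm, then its symbol maps some analytic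
function of pointwise norm one to another such function. -/
lemma exists_unimodular_of_normAttaining [TopologicalSpace.SeparableSpace E] {Φ : LInfty E E} (hΦ : ‖toeplitz Φ‖ = 1)
    (h : NormAttaining (toeplitz Φ)) :
    ∃ f : L2 E, f ∈ H2 E ∧ laurent Φ f ∈ H2 E ∧ (∀ᵐ t ∂circleMeasure, ‖f t‖ = 1) ∧
      ∀ᵐ t ∂circleMeasure, ‖laurent Φ f t‖ = 1 := by
  set L := laurent Φ
  have hL : ∀ f, ‖L f‖ ≤ ‖f‖ := fun f => by
    simpa [hΦ] using norm_laurent_apply_le Φ f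
  -- For a contraction L, the vectors whose norm L preserves are exactly the kernel of L*L - 1,
  -- hence a closed subspace.
  let D : L2 E →L[ℂ] L2 E := (ContinuousLinearMap.adjoint L) ∘L L - ContinuousLinearMap.id ℂ _
  have hinner : ∀ f g, D f = 0 → inner ℂ (L g) (L f) = inner ℂ g f := by
    intro f g hf
    rw [← ContinuousLinearMap.adjoint_inner_right]
    congr 1
    exact sub_eq_zero.1 hf
  -- ‖L*L f - f‖² = ‖L*L f‖² - 2‖L f‖² + ‖f‖² ≤ 0 when ‖L f‖ = ‖f‖.
  have hD : ∀ f, ‖L f‖ = ‖f‖ → D f = 0 := by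
    intro f hf
    have h1 : ‖ContinuousLinearMap.adjoint L (L f)‖ ≤ ‖f‖ := by
      refine ((ContinuousLinearMap.adjoint L).le_opNorm _).trans ?_
      rw [LinearIsometryEquiv.norm_map, hf]
      exact mul_le_of_le_one_left (norm_nonneg _)
        (L.opNorm_le_bound zero_le_one fun g => by rw [one_mul]; exact hL g)
    have h2 : RCLike.re (inner ℂ (ContinuousLinearMap.adjoint L (L f)) f) = ‖f‖ ^ 2 := by
      rw [ContinuousLinearMap.adjoint_inner_left, ← hf]
      exact inner_self_eq_norm_sq (𝕜 := ℂ) _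
    have h3 := @norm_sub_sq ℂ _ _ _ _ (ContinuousLinearMap.adjoint L (L f)) f
    rw [h2] at h3
    have h4 : ‖ContinuousLinearMap.adjoint L (L f)‖ ^ 2 ≤ ‖f‖ ^ 2 :=
      pow_le_pow_left₀ (norm_nonneg _) h1 2
    have h5 : ‖ContinuousLinearMap.adjoint L (L f) - f‖ ^ 2 ≤ 0 := by linarith
    exact norm_eq_zero.1 (pow_eq_zero_iff two_ne_zero |>.1 (le_antisymm h5 (sq_nonneg _)))
  let M : Submodule ℂ (L2 E) :=
    H2 E ⊓ (H2 E).comap L.toLinearMap ⊓ LinearMap.ker D.toLinearMap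
  have hM : ∀ f, f ∈ M ↔ (f ∈ H2 E ∧ L f ∈ H2 E) ∧ D f = 0 := fun f => Iff.rfl
  have hcl : IsClosed (M : Set (L2 E)) :=
    (isClosed_H2.inter (isClosed_H2.preimage L.continuous)).inter D.isClosed_ker
  have hne : M ≠ ⊥ := by
    obtain ⟨f, hf0, hf⟩ := h
    rw [hΦ, one_mul] at hf
    have h1 : ‖(toeplitz Φ f : L2 E)‖ ≤ ‖L f‖ := by
      exact (H2 E).norm_orthogonalProjectionOnto_apply_le (L f)
    have h2 : ‖L f‖ = ‖(f : L2 E)‖ := le_antisymm (hL _) (hf.symm.le.trans h1)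
    -- The projection does not shorten L f, so L f already lies in H².
    have h3 : L f ∈ H2 E := by
      refine ((H2 E).mem_iff_norm_starProjection _).2 ?_
      rw [h2]
      exact hf
    exact (Submodule.ne_bot_iff _).2 ⟨f, (hM _).2 ⟨⟨f.2, h3⟩, hD _ h2⟩, by simpa using hf0⟩
  have hS : ∀ f ∈ M, shift 1 f ∈ M := by
    intro f hf
    obtain ⟨⟨h1, h2⟩, h3⟩ := (hM f).1 hf
    refine (hM _).2 ⟨⟨shift_mem_H2 h1 zero_le_one, ?_⟩, hD _ ?_⟩
    · rw [laurent_shift]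
      exact shift_mem_H2 h2 zero_le_one
    · rw [laurent_shift, norm_shift, norm_shift, @norm_eq_sqrt_re_inner ℂ, hinner f f h3,
        ← @norm_eq_sqrt_re_inner ℂ]
  obtain ⟨f, hfM, hf1, hfw⟩ := exists_wandering_vector hcl (fun f hf => ((hM f).1 hf).1.1) hne hS
  obtain ⟨⟨h1, h2⟩, h3⟩ := (hM f).1 hfM
  refine ⟨f, h1, h2, ae_norm_eq_one hf1 hfw, ae_norm_eq_one ?_ fun n hn => ?_⟩
  · rw [@norm_eq_sqrt_re_inner ℂ, hinner f f h3, ← @norm_eq_sqrt_re_inner ℂ, hf1]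
  · rw [← laurent_shift, hinner _ _ h3, hfw n hn]

lemma exists_inner_of_normAttaining [TopologicalSpace.SeparableSpace E] {Φ : LInfty E E}
    (hΦ : ‖toeplitz Φ‖ = 1) (h : NormAttaining (toeplitz Φ)) {F : Type*} [NormedAddCommGroup F] [InnerProductSpace ℂ F]
    {l : F →L[ℂ] ℂ} (hl : ∀ x, ‖l x‖ = ‖x‖) :
    ∃ (Θ Ψ : ℂ → (F →L[ℂ] E)) (hΘ : IsInner Θ) (hΨ : IsInner Ψ),
      ∀ᵐ t ∂circleMeasure, hΘ.boundary t = Φ t ∘L hΨ.boundary t := by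
  obtain ⟨f, hf, hg, hf1, hg1⟩ := exists_unimodular_of_normAttaining hΦ h
  refine ⟨_, _, isInner_smulRight hl hg hg1, isInner_smulRight hl hf hf1, ?_⟩
  filter_upwards [ae_hasRadialLimitAt_smulRight l hf hf1, ae_hasRadialLimitAt_smulRight l hg hg1,
    laurent_coeFn Φ f] with t h1 h2 h3
  change radialLimit _ t = Φ t ∘L radialLimit _ t
  rw [h1.radialLimit_eq, h2.radialLimit_eq, h3]
  ext x
  simp

lemma normAttaining_of_inner {Φ : LInfty E E} (hΦ : ‖toeplitz Φ‖ = 1) {F : Type*}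
    [NormedAddCommGroup F] [InnerProductSpace ℂ F] [CompleteSpace F] [Nontrivial F]
    {Θ Ψ : ℂ → (F →L[ℂ] E)} (hΘ : IsInner Θ) (hΨ : IsInner Ψ)
    (h : ∀ᵐ t ∂circleMeasure, hΘ.boundary t = Φ t ∘L hΨ.boundary t) :
    NormAttaining (toeplitz Φ) := by
  obtain ⟨y, hy⟩ := exists_ne (0 : F)
  let f : H2 F := ⟨monomial 0 y, monomial_mem_H2 le_rfl y⟩
  have hf : f ≠ 0 := by
    intro h0
    have h1 := fourierCoeff_monomial 0 y 0
    have h2 : monomial 0 y = 0 := congrArg Subtype.val h0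
    have h3 := fourierCoeff_smul_L2 (0 : ℂ) (0 : L2 F) 0
    rw [zero_smul, zero_smul] at h3
    rw [if_pos rfl, h2, h3] at h1
    exact hy h1.symm
  refine ⟨toeplitz hΨ.boundary f, ?_, ?_⟩
  · rw [← norm_ne_zero_iff, norm_toeplitz_boundary, norm_ne_zero_iff]
    exact hf
  · rw [hΦ, one_mul, norm_toeplitz_boundary, ← ContinuousLinearMap.comp_apply,
      ← toeplitz_comp_boundary Φ hΨ h, norm_toeplitz_boundary]

end NormAttaining

end ToeplitzNA

theorem theorem4p1 {E : Type u} [NormedAddCommGroup E] [InnerProductSpace ℂ E] [CompleteSpace E]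
    [TopologicalSpace.SeparableSpace E] (Φ : ToeplitzNA.LInfty E E)
    (hΦ : ‖ToeplitzNA.toeplitz Φ‖ = 1) :
    (ToeplitzNA.NormAttaining (ToeplitzNA.toeplitz Φ) ↔
      ∃ (Es : Type u) (_ : NormedAddCommGroup Es) (_ : InnerProductSpace ℂ Es)
        (_ : CompleteSpace Es) (_ : TopologicalSpace.SeparableSpace Es) (_ : Nontrivial Es)
        (Θ Ψ : ℂ → (Es →L[ℂ] E)) (hΘ : ToeplitzNA.IsInner Θ) (hΨ : ToeplitzNA.IsInner Ψ),
        ∀ᵐ t ∂ToeplitzNA.circleMeasure, hΘ.boundary t = Φ t ∘L hΨ.boundary t) ∧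
    (∀ (Es : Type u) [NormedAddCommGroup Es] [InnerProductSpace ℂ Es]
        [CompleteSpace Es] [TopologicalSpace.SeparableSpace Es]
        (Θ Ψ : ℂ → (Es →L[ℂ] E)) (hΘ : ToeplitzNA.IsInner Θ) (hΨ : ToeplitzNA.IsInner Ψ),
        (∀ᵐ t ∂ToeplitzNA.circleMeasure, hΘ.boundary t = Φ t ∘L hΨ.boundary t) →
        ToeplitzNA.toeplitz hΘ.boundary =
          ToeplitzNA.toeplitz Φ ∘L ToeplitzNA.toeplitz hΨ.boundary) := by
  refine ⟨⟨fun h => ?_, ?_⟩, ?_⟩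
  -- A copy of ℂ in the universe of E, with its coordinate as the isometric functional.
  · exact ⟨EuclideanSpace ℂ PUnit.{u + 1}, inferInstance, inferInstance, inferInstance,
      inferInstance, inferInstance, ToeplitzNA.exists_inner_of_normAttaining hΦ h
        (l := EuclideanSpace.proj PUnit.unit) fun x => by simp [EuclideanSpace.norm_eq]⟩
  · rintro ⟨Es, _, _, _, _, _, Θ, Ψ, hΘ, hΨ, h⟩
    exact ToeplitzNA.normAttaining_of_inner hΦ hΘ hΨ h
  · intro Es _ _ _ _ Θ Ψ hΘ hΨ h
    exact ToeplitzNA.toeplitz_comp_boundary Φ hΨ h
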